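/- Let $K$ be a field, let $m,n,r$ be positive integers, and let $X=(x_{ijk})$ be the $m\times n\times r$ tensor whose entries are $mnr$ independent variables over $K$. Let $X_1$, $X_2$, $X_3$ be flattening matrices of $X$ of the first, second and third kind: $X_1$ is an $m\times nr$ matrix whose columns are the vectors $(x_{ijk})_{1\le i\le m}$, one for each pair $(j,k)$, in any order; $X_2$ is an $n\times mr$ matrix whose columns are the vectors $(x_{ijk})_{1\le j\le n}$, one for each $(i,k)$, in any order; $X_3$ is an $r\times mn$ matrix whose columns are the vectors $(x_{ijk})_{1\le k\le r}$, one for each $(i,j)$, in any order. Let $u,v,w$ be integers with $$2\le u\le \min(m,rn),\qquad 2\le v\le\min(n,mr),\qquad 2\le w\le\min(r,mn).$$ In the polynomial ring $K[x_{ijk}]$, let $I_{u,v}$ be the ideal generated by the $u$-minors of $X_1$ and the $v$-minors of $X_2$ (the double determinantal ideal), and let $I_{u,v,w}$ be the ideal generated by the $u$-minors of $X_1$, the $v$-minors of $X_2$ and the $w$-minors of $X_3$ (the triple determinantal ideal). Then $$I_{u,v}=I_{u,v,w}\iff (u-1)(v-1)\le w-1 .$$ Moreover, if the largest of the numbers $u-1,v-1,w-1$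 is not less than the product of the other two, then $I_{u,v,w}$ is a double determinantal ideal, that is, after arranging the variables $x_{ijk}$ (each exactly once) in a suitable $3$-dimensional tensor, it is generated by the minors of some fixed positive size of a first flattening matrix and the minors of some fixed positive size of a second flattening matrix of that tensor. More precisely, $I_{u,v,w}$ is then generated by the minors, of the two corresponding sizes, of those two of $X_1,X_2,X_3$ that correspond to the other two numbers: if $(u-1)(v-1)\le w-1$ then $I_{u,v,w}=I_{u,v}$; if $(u-1)(w-1)\le v-1$ then $I_{u,v,w}$ is generated by the $u$-minors of $X_1$ and the $w$-minors of $X_3$; if $(v-1)(w-1)\le u-1$ then $I_{u,v,w}$ is generated by the $v$-minors of $X_2$ and the $w$-minors of $X_3$. -/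

import Mathlib

/-- `D_u(A)`: the set of `u`-minors of the matrix `A`, that is, the determinants of its
`u × u` submatrices (`u` rows and `u` columns, each listed in increasing order). -/
def minorSet {R : Type*} [CommRing R] {a b : ℕ} (u : ℕ) (A : Matrix (Fin a) (Fin b) R) : Set R :=
  {d | ∃ (f : Fin u ↪o Fin a) (g : Fin u ↪o Fin b), d = (A.submatrix f g).det}

/-- The `m × n × r` tensor of independent variables, whose `(i, j, k)` entry is the variable
`x_{ijk}` of the polynomial ring over `K` in `m * n * r` variables. -/
noncomputable def genericTensor (K : Type*) [Field K] (m n r : ℕ) :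
    Fin m → Fin n → Fin r → MvPolynomial (Fin m × Fin n × Fin r) K :=
  fun i j k => MvPolynomial.X (i, j, k)

/-- The first flattening class of a tensor `T` of size `m × n × r`: all `m × (n * r)` matrices
whose columns are the vectors `(T i j k)_i`, one column for every `(j, k)`, in any order. -/
def firstFlattenings {R : Type*} {m n r : ℕ} (T : Fin m → Fin n → Fin r → R) :
    Set (Matrix (Fin m) (Fin (n * r)) R) :=
  {M | ∃ e : Fin (n * r) ≃ Fin n × Fin r, M = Matrix.of fun i c => T i (e c).1 (e c).2}

/-- The second flattening class of a tensor `T` of size `m × n × r`: all `n × (m * r)` matrices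
whose columns are the vectors `(T i j k)_j`, one column for every `(i, k)`, in any order. -/
def secondFlattenings {R : Type*} {m n r : ℕ} (T : Fin m → Fin n → Fin r → R) :
    Set (Matrix (Fin n) (Fin (m * r)) R) :=
  {M | ∃ e : Fin (m * r) ≃ Fin m × Fin r, M = Matrix.of fun j c => T (e c).1 j (e c).2}

/-- The third flattening class of a tensor `T` of size `m × n × r`: all `r × (m * n)` matrices
whose columns are the vectors `(T i j k)_k`, one column for every `(i, j)`, in any order. -/
def thirdFlattenings {R : Type*} {m n r : ℕ} (T : Fin m → Fin n → Fin r → R) :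
    Set (Matrix (Fin r) (Fin (m * n)) R) :=
  {M | ∃ e : Fin (m * n) ≃ Fin m × Fin n, M = Matrix.of fun k c => T (e c).1 (e c).2 k}

/-- The ideal generated by the `u`-minors of `A` and the `v`-minors of `B`. For flattening matrices
`A`, `B` (of two different classes) of the generic tensor this is a double determinantal ideal. -/
def doubleIdeal {R : Type*} [CommRing R] {a b c d : ℕ} (u v : ℕ)
    (A : Matrix (Fin a) (Fin b) R) (B : Matrix (Fin c) (Fin d) R) : Ideal R :=
  Ideal.span (minorSet u A ∪ minorSet v B)

/-- The ideal generated by the `u`-minors of `A`, the `v`-minors of `B` and the `w`-minors of `C`.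
For flattening matrices `A`, `B`, `C` of the three classes of the generic tensor this is the
triple determinantal ideal. -/
def tripleIdeal {R : Type*} [CommRing R] {a b c d p q : ℕ} (u v w : ℕ)
    (A : Matrix (Fin a) (Fin b) R) (B : Matrix (Fin c) (Fin d) R)
    (C : Matrix (Fin p) (Fin q) R) : Ideal R :=
  Ideal.span (minorSet u A ∪ minorSet v B ∪ minorSet w C)

/-- An ideal `I` of a polynomial ring is a double determinantal ideal if all the variables of the
ring can be arranged (each exactly once) in a tensor such that `I` is generated by the `a`-minors
of a first flattening matrix and the `b`-minors of a second flattening matrix of that tensor, for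
some positive integers `a` and `b`. -/
def IsDoubleDeterminantal {K σ : Type*} [Field K] (I : Ideal (MvPolynomial σ K)) : Prop :=
  ∃ (p q s a b : ℕ) (e : Fin p × Fin q × Fin s ≃ σ),
    0 < a ∧ 0 < b ∧
    ∃ Y₁ ∈ firstFlattenings
        (fun i j k => (MvPolynomial.X (e (i, j, k)) : MvPolynomial σ K)),
    ∃ Y₂ ∈ secondFlattenings
        (fun i j k => (MvPolynomial.X (e (i, j, k)) : MvPolynomial σ K)),
      I = doubleIdeal a b Y₁ Y₂

open Equiv Equiv.Perm

/-! Expand a `w`-minor of the third flattening as the signed sum of φ(σ, σ), where φ(σ, τ) = ∏ T (σ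
s) (τ s) s. Put d = u - 1 and d' = v - 1, so that w > d * d'. Modulo the `u`- and `v`-minors, φ is
killed by alternating sums over d + 1 positions in σ and over d' + 1 positions in τ. Straightening
(`exists_straightening`) therefore rewrites the minor as ∑ D β γ • φ(β, γ) over β, γ that split into
d, respectively d', increasing subsequences, with D independent of the tensor. To see D = 0, replace
φ by products of 0/1 indicators of words in d and d' letters. These obey the same relations, and the
minor becomes a determinant with only d * d' < w possible distinct rows, hence 0. Since standard
permutations are independent on words (`eq_zero_of_sum_words_eq_zero`), D vanishes. No division
occurs, so the argument is independent of the characteristic. For the converse, if w ≤ d * d', a 0/1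
tensor supported in a d × d' block of (i, j), with k enumerating the block, kills the first two
kinds of minors but has a `w`-minor equal to 1. -/

/-! ### Increasing colourings and decreasing subsequences. -/

/-- A map `f` on `Fin N` splits into `d` increasing subsequences. -/
def HasIncreasingColoring {N : ℕ} {α : Type*} [LinearOrder α] (d : ℕ) (f : Fin N → α) : Prop :=
  ∃ c : Fin N → Fin d, ∀ s t, s < t → c s = c t → f s < f t

/-- Peel off the left-to-right maxima: they form an increasing subsequence, and every other element
has a larger value before it, so a decreasing sequence among the others can be prolonged at the
front. -/
theorem exists_coloring_or_strictAnti {N : ℕ} {α : Type*} [LinearOrder α] {f : Fin N → α}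
    (hf : Function.Injective f) (d : ℕ) (S : Finset (Fin N)) :
    (∃ c : Fin N → ℕ, (∀ s ∈ S, c s < d) ∧
      ∀ s ∈ S, ∀ t ∈ S, s < t → c s = c t → f s < f t) ∨
    ∃ p : Fin (d + 1) → Fin N, (∀ a, p a ∈ S) ∧ StrictMono p ∧ StrictAnti (f ∘ p) := by
  induction d generalizing S with
  | zero =>
    rcases S.eq_empty_or_nonempty with rfl | ⟨x, hx⟩
    · exact Or.inl ⟨fun _ => 0, by simp, by simp⟩
    · exact Or.inr ⟨fun _ => x, fun _ => hx, fun a b h => absurd h (by omega), fun a b h => absurd h (by omega)⟩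
  | succ d ih =>
    classical
    set S' := S.filter fun s => ∃ t ∈ S, t < s ∧ f s < f t with hS'
    rcases ih S' with ⟨c, hc, hcf⟩ | ⟨p, hpS, hp, hfp⟩
    · refine Or.inl ⟨fun s => if s ∈ S' then c s else d, fun s _ => ?_, fun s hs t ht hst h => ?_⟩
      · dsimp only
        split_ifs with h
        · exact (hc s h).trans d.lt_succ_self
        · exact d.lt_succ_self
      · dsimp only at h
        split_ifs at h with h1 h2 h2
        · exact hcf s h1 t h2 hst h
        · exact absurd h (hc s h1).ne
        · exact absurd h.symm (hc t h2).ne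
        · by_contra hlt
          refine h2 (Finset.mem_filter.2 ⟨ht, s, hs, hst, lt_of_le_of_ne (not_lt.1 hlt) ?_⟩)
          exact fun h => hst.ne' (hf h)
    · obtain ⟨-, t, ht, htp, hft⟩ := Finset.mem_filter.1 (hpS 0)
      refine Or.inr ⟨Fin.cons t p, ?_, ?_, ?_⟩
      · refine Fin.cases ?_ fun a => ?_
        · simpa using ht
        · simpa using (Finset.mem_filter.1 (hpS a)).1
      · refine Fin.strictMono_iff_lt_succ.2 (Fin.cases ?_ fun a => ?_)
        · simpa using htp
        · rw [← Fin.succ_castSucc]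
          simpa using hp (Fin.castSucc_lt_succ (i := a))
      · refine Fin.strictAnti_iff_succ_lt.2 (Fin.cases ?_ fun a => ?_)
        · simpa using hft
        · rw [← Fin.succ_castSucc]
          simpa using hfp (Fin.castSucc_lt_succ (i := a))

theorem hasIncreasingColoring_or_strictAnti {N : ℕ} {α : Type*} [LinearOrder α] {f : Fin N → α}
    (hf : Function.Injective f) (d : ℕ) :
    HasIncreasingColoring d f ∨
      ∃ p : Fin (d + 1) → Fin N, StrictMono p ∧ StrictAnti (f ∘ p) := by
  rcases exists_coloring_or_strictAnti hf d Finset.univ with ⟨c, hc, h⟩ | ⟨p, -, h⟩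
  · exact Or.inl ⟨fun s => ⟨c s, hc s (Finset.mem_univ s)⟩, fun s t hst hs =>
      h s (Finset.mem_univ s) t (Finset.mem_univ t) hst (by simpa using hs)⟩
  · exact Or.inr ⟨p, h⟩

/-- At the least moved point all smaller values are already taken, so the point can only move up.
This drives both lexicographic arguments below. -/
theorem Equiv.Perm.exists_first_moved {N : ℕ} {π : Perm (Fin N)} (h : π ≠ 1) :
    ∃ s, (∀ t < s, π t = t) ∧ s < π s := by
  classical
  obtain ⟨s, hs, hmin⟩ := (Finset.univ.filter fun s => π s ≠ s).exists_minimal (by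
    by_contra hne
    refine h (Equiv.ext fun s => ?_)
    by_contra hs
    exact hne ⟨s, by simpa using hs⟩)
  have hfix : ∀ t < s, π t = t := fun t ht => by
    by_contra hne
    exact absurd (hmin (by simpa using hne) ht.le) (not_le.2 ht)
  refine ⟨s, hfix, lt_of_le_of_ne (not_lt.1 fun hlt => ?_) (Ne.symm (by simpa using hs))⟩
  exact hlt.ne (π.injective (hfix _ hlt))

/-! ### Straightening and independence of standard permutations. -/

/-- The alternating sum of `φ` over the permutations of the positions in the range of `p`. -/
def alternatingSum {N u : ℕ} {M : Type*} [AddCommGroup M] (φ : Perm (Fin N) → M)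
    (p : Fin u ↪ Fin N) (σ : Perm (Fin N)) : M :=
  ∑ π : Perm (Fin u), (sign π : ℤ) • φ (σ * π.viaFintypeEmbedding p)

/-- Factors at positions outside `p` do not change; the remaining ones assemble into the Leibniz
expansion of a minor. -/
theorem alternatingSum_prod {N u : ℕ} {R : Type*} [CommRing R] (y : Fin N → Fin N → R)
    (p : Fin u ↪ Fin N) (σ : Perm (Fin N)) :
    alternatingSum (fun σ => ∏ s, y (σ s) s) p σ =
      (∏ s ∈ (Finset.univ.map p)ᶜ, y (σ s) s) *
        (Matrix.of fun a b => y (σ (p a)) (p b)).det := by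
  rw [alternatingSum, Matrix.det_apply, Finset.mul_sum]
  refine Finset.sum_congr rfl fun π _ => ?_
  rw [← Finset.prod_mul_prod_compl (Finset.univ.map p), Finset.prod_map, mul_comm,
    Units.smul_def, mul_smul_comm]
  congr 2
  · refine Finset.prod_congr rfl fun s hs => ?_
    rw [Perm.mul_apply, viaFintypeEmbedding_apply_notMem_range]
    simpa using hs
  · refine Finset.prod_congr rfl fun a _ => ?_
    rw [Perm.mul_apply, viaFintypeEmbedding_apply_image]
    rfl

/-- Standard permutations span: modulo alternating sums of length `d + 1`, every permutation is a
combination of those that split into `d` increasing subsequences. -/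
theorem exists_straightening.{x} {K : Type x} [CommRing K] (N d : ℕ) (σ : Perm (Fin N)) :
    ∃ α : Perm (Fin N) → K, (∀ β : Perm (Fin N), ¬ HasIncreasingColoring d β → α β = 0) ∧
      ∀ (M : Type x) [AddCommGroup M] [Module K M] (φ : Perm (Fin N) → M),
        (∀ (p : Fin (d + 1) ↪ Fin N) τ, alternatingSum φ p τ = 0) →
        φ σ = ∑ β, α β • φ β := by
  classical
  induction h : toLex (σ : Fin N → Fin N) using WellFoundedLT.induction generalizing σ with
  | _ x ih =>
  subst h
  rcases hasIncreasingColoring_or_strictAnti σ.injective d with hσ | ⟨p, hp, hσp⟩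
  · refine ⟨Pi.single σ 1, fun β hβ => Pi.single_eq_of_ne (by rintro rfl; exact hβ hσ) _, ?_⟩
    intro M _ _ φ _
    rw [Finset.sum_eq_single σ] <;> simp +contextual
  · let P : Fin (d + 1) ↪ Fin N := ⟨p, hp.injective⟩
    -- The first position moved by `π` lies on `p` and moves up; `σ` decreases along `p`, so the
    -- value there drops. The alternating relation thus expresses `φ σ` through lexicographically
    -- smaller permutations.
    have key : ∀ π : Perm (Fin (d + 1)), π ≠ 1 →
        toLex ⇑(σ * π.viaFintypeEmbedding P) < toLex ⇑σ := by
      intro π hπ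
      have hne : π.viaFintypeEmbedding P ≠ 1 := fun h => hπ <| Equiv.ext fun a => by
        have := viaFintypeEmbedding_apply_image π P a
        rw [h] at this
        exact P.injective this.symm
      obtain ⟨s, hfix, hs⟩ := exists_first_moved hne
      refine ⟨s, fun t ht => congrArg σ (hfix t ht), ?_⟩
      by_cases hmem : s ∈ Set.range P
      · obtain ⟨a, rfl⟩ := hmem
        rw [viaFintypeEmbedding_apply_image] at hs
        change σ (π.viaFintypeEmbedding P (P a)) < σ (P a)
        rw [viaFintypeEmbedding_apply_image]
        exact hσp (hp.lt_iff_lt.1 hs)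
      · rw [viaFintypeEmbedding_apply_notMem_range _ _ hmem] at hs
        exact absurd hs (lt_irrefl s)
    have hα : ∀ π : Perm (Fin (d + 1)), ∃ α : Perm (Fin N) → K,
        (∀ β : Perm (Fin N), ¬ HasIncreasingColoring d β → α β = 0) ∧
        (π ≠ 1 → ∀ (M : Type x) [AddCommGroup M] [Module K M] (φ : Perm (Fin N) → M),
        (∀ (p : Fin (d + 1) ↪ Fin N) τ, alternatingSum φ p τ = 0) →
        φ (σ * π.viaFintypeEmbedding P) = ∑ β, α β • φ β) := by
      intro π
      by_cases hπ : π = 1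
      · exact ⟨0, fun _ _ => rfl, fun h => absurd hπ h⟩
      · obtain ⟨α, h1, h2⟩ := ih _ (key π hπ) _ rfl
        exact ⟨α, h1, fun _ => h2⟩
    choose α hα0 hα using hα
    refine ⟨-∑ π ∈ Finset.univ.erase 1, (sign π : ℤ) • α π, fun β hβ => ?_, ?_⟩
    · simp [hα0 _ β hβ]
    · intro M _ _ φ hφ
      have h0 := hφ P σ
      have hone : (1 : Perm (Fin (d + 1))).viaFintypeEmbedding P = 1 :=
        extendDomain_one _
      rw [alternatingSum, ← Finset.add_sum_erase _ _ (Finset.mem_univ 1), hone, Perm.sign_one,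
        Units.val_one, one_smul, mul_one] at h0
      rw [eq_neg_of_add_eq_zero_left h0]
      simp only [Pi.neg_apply, Finset.sum_apply, Pi.smul_apply, neg_smul, Finset.sum_neg_distrib,
        Finset.sum_smul, smul_assoc]
      rw [Finset.sum_comm]
      congr 1
      refine Finset.sum_congr rfl fun π hπ => ?_
      rw [hα π (Finset.ne_of_mem_erase hπ) M φ hφ, Finset.smul_sum]

/-- Standard permutations are independent as operators on words with `d` letters. -/
theorem eq_zero_of_sum_words_eq_zero {K : Type*} [CommRing K] {N d : ℕ} (a : Perm (Fin N) → K)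
    (ha : ∀ β : Perm (Fin N), ¬ HasIncreasingColoring d β → a β = 0)
    (h : ∀ c c' : Fin N → Fin d, ∑ β, a β * ∏ s, (if c' (β s) = c s then 1 else 0) = 0) :
    a = 0 := by
  classical
  by_contra hne
  obtain ⟨σ, hσ, hmax⟩ := (Finset.univ.filter fun β => a β ≠ 0).exists_maximalFor
    (fun β : Perm (Fin N) => toLex (β : Fin N → Fin N)) (by
      obtain ⟨β, hβ⟩ := Function.ne_iff.1 hne
      exact ⟨β, by simpa using hβ⟩)
  have hσ0 : a σ ≠ 0 := by simpa using hσ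
  obtain ⟨c, hc⟩ : HasIncreasingColoring d σ := not_not.1 fun h => hσ0 (ha σ h)
  refine hσ0 ?_
  -- For these words a permutation `τ` contributes only if `σ⁻¹ * τ` preserves colours. As `σ`
  -- increases on each colour class, such a `τ ≠ σ` is lexicographically larger, which maximality
  -- excludes.
  have := h c (c ∘ σ.symm)
  rw [Finset.sum_eq_single σ ?_ (by simp)] at this
  · simpa using this
  intro τ _ hτ
  by_contra hprod
  have hcol : ∀ s, c (σ.symm (τ s)) = c s := by
    intro s
    by_contra hs
    exact hprod (by
      rw [Finset.prod_eq_zero (Finset.mem_univ s), mul_zero]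
      exact if_neg hs)
  have hπ : σ⁻¹ * τ ≠ 1 := fun h => hτ (inv_mul_eq_one.1 h).symm
  obtain ⟨s, hfix, hs⟩ := exists_first_moved hπ
  have hτσ : ∀ t, τ t = σ ((σ⁻¹ * τ) t) := fun t => by simp
  have hlt : toLex (σ : Fin N → Fin N) < toLex (τ : Fin N → Fin N) := by
    refine ⟨s, fun t ht => ?_, ?_⟩
    · change σ t = τ t
      rw [hτσ, hfix t ht]
    · change σ s < τ s
      rw [hτσ]
      exact hc _ _ hs (hcol s).symm
  have hτ0 : a τ ≠ 0 := fun h => hprod (by rw [h, zero_mul])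
  exact absurd (hmax (by simpa using hτ0) hlt.le) (not_le.2 hlt)

/-! ### The containment of the third kind of minors. -/

/-- A determinant with more rows than letters vanishes when each entry depends on its row only
through a letter. -/
theorem Matrix.det_eq_zero_of_row_factor {R : Type*} [CommRing R] {u : ℕ} {α : Type*} [Fintype α]
    (hα : Fintype.card α < u) (l : Fin u → α) (f : α → Fin u → R) :
    (Matrix.of fun a b => f (l a) b).det = 0 := by
  obtain ⟨a, b, hab, h⟩ := Fintype.exists_ne_map_eq_of_card_lt l (by simpa using hα)
  exact Matrix.det_zero_of_row_eq hab (by ext; simp [h])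

/-- The minors of size `N > d * d'` of the third flattening of a tensor lie in every ideal that
contains the `(d + 1)`-minors of the first and the `(d' + 1)`-minors of the second flattening. -/
theorem det_mem_of_flattening_minors_mem {R : Type*} [CommRing R]
    {N d d' : ℕ} (hN : d * d' < N) (I : Ideal R) (T : Fin N → Fin N → Fin N → R)
    (h₁ : ∀ f g h : Fin (d + 1) → Fin N, (Matrix.of fun a b => T (f a) (g b) (h b)).det ∈ I)
    (h₂ : ∀ f g h : Fin (d' + 1) → Fin N, (Matrix.of fun a b => T (g b) (f a) (h b)).det ∈ I) :
    (Matrix.of fun s t => T s s t).det ∈ I := by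
  classical
  let φ : Perm (Fin N) → Perm (Fin N) → R ⧸ I := fun σ τ =>
    ∏ s, Ideal.Quotient.mk I (T (σ s) (τ s) s)
  have hφ₁ : ∀ τ (p : Fin (d + 1) ↪ Fin N) σ, alternatingSum (fun σ => φ σ τ) p σ = 0 := by
    intro τ p σ
    rw [alternatingSum_prod fun t s => Ideal.Quotient.mk I (T t (τ s) s)]
    have := Ideal.Quotient.eq_zero_iff_mem.2 (h₁ (fun a => σ (p a)) (fun b => τ (p b)) p)
    rw [RingHom.map_det] at this
    exact mul_eq_zero_of_right _ this
  have hφ₂ : ∀ σ (p : Fin (d' + 1) ↪ Fin N) τ, alternatingSum (fun τ => φ σ τ) p τ = 0 := by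
    intro σ p τ
    rw [alternatingSum_prod fun t s => Ideal.Quotient.mk I (T (σ s) t s)]
    have := Ideal.Quotient.eq_zero_iff_mem.2 (h₂ (fun a => τ (p a)) (fun b => σ (p b)) p)
    rw [RingHom.map_det] at this
    exact mul_eq_zero_of_right _ this
  -- Coefficients are taken in `R`, so that the same ones serve for values in `R ⧸ I` and for the
  -- test functions with values in `R`.
  choose α hα0 hα using exists_straightening (K := R) N d
  choose α' hα0' hα' using exists_straightening (K := R) N d'
  have hword : ∀ {k : ℕ} (c c' : Fin N → Fin k) (p : Fin (k + 1) ↪ Fin N) σ,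
      alternatingSum (fun σ => ∏ s, (if c' (σ s) = c s then 1 else 0 : R)) p σ = 0 := by
    intro k c c' p σ
    rw [alternatingSum_prod fun t s => (if c' t = c s then 1 else 0 : R)]
    exact mul_eq_zero_of_right _ (Matrix.det_eq_zero_of_row_factor (α := Fin k) (by simp)
      (fun a => c' (σ (p a))) fun l b => if l = c (p b) then 1 else 0)
  -- The coefficient of `φ β γ` once both arguments are straightened.
  let D : Perm (Fin N) → Perm (Fin N) → R := fun β γ =>
    ∑ σ : Perm (Fin N), ((sign σ : ℤ) : R) * (α σ β * α' σ γ)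
  have hD : ∀ β, D β = 0 := by
    intro β
    -- Independence is used twice: in `γ` with words `e, e'`, then in `β` with words `c, c'`.
    refine eq_zero_of_sum_words_eq_zero (d := d') (D β) (fun γ hγ => by simp [D, hα0' _ γ hγ]) ?_
    intro e e'
    refine congrFun (eq_zero_of_sum_words_eq_zero (d := d)
      (fun β => ∑ γ, D β γ * ∏ s, (if e' (γ s) = e s then 1 else 0))
      (fun β hβ => by simp [D, hα0 _ β hβ]) ?_) β
    intro c c'
    have hdet : (Matrix.of fun t s => (if c' t = c s then 1 else 0 : R) *
        (if e' t = e s then 1 else 0)).det = 0 :=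
      Matrix.det_eq_zero_of_row_factor (α := Fin d × Fin d') (by simpa using hN)
        (fun t => (c' t, e' t))
        fun l s => (if l.1 = c s then 1 else 0) * (if l.2 = e s then 1 else 0)
    rw [Matrix.det_apply] at hdet
    let E : Perm (Fin N) → R := fun σ => ∏ s, if c' (σ s) = c s then 1 else 0
    let E' : Perm (Fin N) → R := fun σ => ∏ s, if e' (σ s) = e s then 1 else 0
    have hE : ∀ σ, ∑ β, α σ β * E β = E σ := fun σ => (hα σ R E (hword c c')).symm
    have hE' : ∀ σ, ∑ γ, α' σ γ * E' γ = E' σ := fun σ => (hα' σ R E' (hword e e')).symm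
    calc ∑ β, (∑ γ, D β γ * E' γ) * E β
        = ∑ σ : Perm (Fin N), ((sign σ : ℤ) : R) *
            ((∑ β, α σ β * E β) * (∑ γ, α' σ γ * E' γ)) := by
          simp only [D, Finset.sum_mul, Finset.mul_sum]
          rw [Finset.sum_comm_cycle]
          refine Finset.sum_congr rfl fun σ _ => ?_
          rw [Finset.sum_comm]
          exact Finset.sum_congr rfl fun _ _ => Finset.sum_congr rfl fun _ _ => by ring
      _ = 0 := by
          rw [← hdet]
          refine Finset.sum_congr rfl fun σ _ => ?_
          rw [hE, hE', Units.smul_def, zsmul_eq_mul]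
          simp only [Matrix.of_apply, Finset.prod_mul_distrib, E, E']
  have hdet : Ideal.Quotient.mk I (Matrix.of fun s t => T s s t).det =
      ∑ σ : Perm (Fin N), (sign σ : ℤ) • φ σ σ := by
    rw [RingHom.map_det, Matrix.det_apply]
    rfl
  rw [← Ideal.Quotient.eq_zero_iff_mem, hdet]
  have hexp : ∀ σ, φ σ σ = ∑ β, ∑ γ, (α σ β * α' σ γ) • φ β γ := by
    intro σ
    rw [hα σ _ (fun β => φ β σ) (hφ₁ σ)]
    refine Finset.sum_congr rfl fun β _ => ?_
    rw [hα' σ _ (fun γ => φ β γ) (hφ₂ β), Finset.smul_sum]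
    simp only [mul_smul]
  have : ∑ σ : Perm (Fin N), (sign σ : ℤ) • φ σ σ = ∑ β, ∑ γ, D β γ • φ β γ := by
    simp only [hexp, Finset.smul_sum, D, Finset.sum_smul, mul_smul, Int.cast_smul_eq_zsmul]
    rw [Finset.sum_comm]
    refine Finset.sum_congr rfl fun β _ => ?_
    rw [Finset.sum_comm]
  rw [this]
  simp [hD]

/-! ### Minor ideals with arbitrary row and column choices. -/

/-- The ideal generated by the `u`-minors of the matrix of shape `Fin a × β` with entries `A`. -/
def minorIdeal {R β : Type*} [CommRing R] {a : ℕ} (u : ℕ) (A : Fin a → β → R) : Ideal R :=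
  Ideal.span {x | ∃ (f : Fin u → Fin a) (g : Fin u → β),
    x = (Matrix.of fun s t => A (f s) (g t)).det}

theorem det_mem_minorIdeal {R β : Type*} [CommRing R] {a u : ℕ} (A : Fin a → β → R)
    (f : Fin u → Fin a) (g : Fin u → β) :
    (Matrix.of fun s t => A (f s) (g t)).det ∈ minorIdeal u A :=
  Ideal.subset_span ⟨f, g, rfl⟩

theorem exists_orderEmbedding_comp_perm {u a : ℕ} {f : Fin u → Fin a}
    (hf : Function.Injective f) : ∃ (f₀ : Fin u ↪o Fin a) (π : Perm (Fin u)), f = f₀ ∘ π := by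
  refine ⟨OrderEmbedding.ofStrictMono (f ∘ Tuple.sort f)
    ((Tuple.monotone_sort f).strictMono_of_injective (hf.comp (Tuple.sort f).injective)), (Tuple.sort f).symm, ?_⟩
  ext s
  simp

/-- A repeated row or column gives determinant zero, and reordering changes only the sign; so the
order of the columns of a flattening is irrelevant. -/
theorem Ideal.span_minorSet_eq_minorIdeal {R β : Type*} [CommRing R] {a b : ℕ} (u : ℕ)
    (A : Fin a → β → R) (e : Fin b ≃ β) :
    Ideal.span (minorSet u (Matrix.of fun i c => A i (e c))) = minorIdeal u A := by
  refine le_antisymm (Ideal.span_le.2 ?_) (Ideal.span_le.2 ?_)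
  · rintro _ ⟨f, g, rfl⟩
    exact det_mem_minorIdeal A f fun t => e (g t)
  · rintro _ ⟨f, g, rfl⟩
    by_cases hf : Function.Injective f
    · by_cases hg : Function.Injective g
      · obtain ⟨f₀, π, rfl⟩ := exists_orderEmbedding_comp_perm hf
        obtain ⟨g₀, ρ, hρ⟩ := exists_orderEmbedding_comp_perm (e.symm.injective.comp hg)
        have : (Matrix.of fun s t => A ((f₀ ∘ π) s) (g t)) =
            (((Matrix.of fun i c => A i (e c)).submatrix f₀ g₀).submatrix π id).submatrix id ρ := by
          ext s t
          have h := congrFun hρ t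
          simp only [Function.comp_apply] at h
          simp [← h]
        rw [this, Matrix.det_permute', Matrix.det_permute]
        exact Ideal.mul_mem_left _ _ (Ideal.mul_mem_left _ _ (Ideal.subset_span ⟨f₀, g₀, rfl⟩))
      · obtain ⟨s, t, h, hst⟩ := Function.not_injective_iff.1 hg
        rw [Matrix.det_zero_of_column_eq hst (by simp [h])]
        exact Ideal.zero_mem _
    · obtain ⟨s, t, h, hst⟩ := Function.not_injective_iff.1 hf
      rw [Matrix.det_zero_of_row_eq hst (by ext; simp [h])]
      exact Ideal.zero_mem _

theorem minorIdeal_comp_equiv {R β γ : Type*} [CommRing R] {a : ℕ} (u : ℕ) (A : Fin a → β → R)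
    (e : γ ≃ β) : minorIdeal u (fun i c => A i (e c)) = minorIdeal u A := by
  refine le_antisymm (Ideal.span_le.2 ?_) (Ideal.span_le.2 ?_)
  · rintro _ ⟨f, g, rfl⟩
    exact det_mem_minorIdeal A f fun t => e (g t)
  · rintro _ ⟨f, g, rfl⟩
    simpa using det_mem_minorIdeal (fun i c => A i (e c)) f fun t => e.symm (g t)

/-- For a three-dimensional tensor, the minors of size `w > (u - 1) * (v - 1)` of the third
flattening lie in the ideal of the `u`-minors of the first and the `v`-minors of the second. -/
theorem minorIdeal_third_le {R : Type*} [CommRing R] {m n r u v w : ℕ} (hu : 0 < u) (hv : 0 < v)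
    (hw : 0 < w) (h : (u - 1) * (v - 1) ≤ w - 1) (T : Fin m → Fin n → Fin r → R) :
    minorIdeal w (fun k (c : Fin m × Fin n) => T c.1 c.2 k) ≤
      minorIdeal u (fun i (c : Fin n × Fin r) => T i c.1 c.2) ⊔
        minorIdeal v (fun j (c : Fin m × Fin r) => T c.1 j c.2) := by
  refine Ideal.span_le.2 ?_
  rintro _ ⟨f, g, rfl⟩
  obtain ⟨d, rfl⟩ := Nat.exists_eq_add_of_lt hu
  obtain ⟨d', rfl⟩ := Nat.exists_eq_add_of_lt hv
  simp only [zero_add, Nat.add_sub_cancel] at h ⊢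
  -- After transposing, row `s` carries the column index `g s`, a pair. Its two components index the
  -- first two directions of an auxiliary cubical tensor, whose diagonal entries are those of the
  -- minor.
  rw [← Matrix.det_transpose]
  exact det_mem_of_flattening_minors_mem (d := d) (d' := d') (by omega) _
    (fun s t k => T (g s).1 (g t).2 (f k))
    (fun a b c => Ideal.mem_sup_left
      (det_mem_minorIdeal (fun i (c : Fin n × Fin r) => T i c.1 c.2) (fun s => (g (a s)).1)
        fun t => ((g (b t)).2, f (c t))))
    (fun a b c => Ideal.mem_sup_right
      (det_mem_minorIdeal (fun j (c : Fin m × Fin r) => T c.1 j c.2) (fun s => (g (a s)).2)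
        fun t => ((g (b t)).1, f (c t))))

theorem minorIdeal_eq_bot_of_rows {R β : Type*} [CommRing R] {a u : ℕ} (hu : 0 < u)
    (A : Fin a → β → R) (hA : ∀ (i : Fin a) c, u - 1 ≤ (i : ℕ) → A i c = 0) : minorIdeal u A = ⊥ := by
  refine (Ideal.span_eq_bot).2 ?_
  rintro _ ⟨f, g, rfl⟩
  by_cases h : ∃ s, u - 1 ≤ (f s : ℕ)
  · obtain ⟨s, hs⟩ := h
    exact Matrix.det_eq_zero_of_row_eq_zero s fun t => hA _ _ hs
  · push Not at h
    obtain ⟨s, t, hst, he⟩ := Fintype.exists_ne_map_eq_of_card_lt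
      (fun s => (⟨f s, h s⟩ : Fin (u - 1))) (by simp; omega)
    have he : f s = f t := by simpa [Fin.ext_iff] using he
    exact Matrix.det_zero_of_row_eq hst (by ext; simp [he])

theorem map_minorIdeal {R S β : Type*} [CommRing R] [CommRing S] {a : ℕ} (u : ℕ)
    (A : Fin a → β → R) (φ : R →+* S) :
    (minorIdeal u A).map φ = minorIdeal u fun i c => φ (A i c) := by
  rw [minorIdeal, minorIdeal, Ideal.map_span]
  congr 1
  ext x
  constructor
  · rintro ⟨_, ⟨f, g, rfl⟩, rfl⟩
    exact ⟨f, g, by rw [RingHom.map_det]; rfl⟩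
  · rintro ⟨f, g, rfl⟩
    exact ⟨_, ⟨f, g, rfl⟩, by rw [RingHom.map_det]; rfl⟩

/-! ### Sharpness of the bound, and the theorem. -/

/-- When `w ≤ (u - 1) * (v - 1)`, the `w`-minors of the third flattening of the generic tensor do
not all lie in the ideal of the `u`-minors of the first and the `v`-minors of the second. -/
theorem not_minorIdeal_third_le (K : Type*) [Field K] {m n r u v w : ℕ} (hu : 0 < u) (hv : 0 < v)
    (hum : u ≤ m) (hvn : v ≤ n) (hwr : w ≤ r) (h : w ≤ (u - 1) * (v - 1)) :
    ¬ minorIdeal w (fun k (c : Fin m × Fin n) => genericTensor K m n r c.1 c.2 k) ≤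
      minorIdeal u (fun i (c : Fin n × Fin r) => genericTensor K m n r i c.1 c.2) ⊔
        minorIdeal v (fun j (c : Fin m × Fin r) => genericTensor K m n r c.1 j c.2) := by
  intro hle
  -- The first two flattenings of this point have at most `u - 1`, respectively `v - 1`, nonzero
  -- rows; `k = i * (v - 1) + j` numbers the pairs of the block.
  let t : Fin m × Fin n × Fin r → K := fun x =>
    if (x.1 : ℕ) < u - 1 ∧ (x.2.1 : ℕ) < v - 1 ∧ (x.1 : ℕ) * (v - 1) + x.2.1 = x.2.2 then 1 else 0
  have hle := Ideal.map_mono (f := (MvPolynomial.aeval t : _ →ₐ[K] K).toRingHom) hle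
  rw [Ideal.map_sup, map_minorIdeal, map_minorIdeal, map_minorIdeal] at hle
  simp only [genericTensor, AlgHom.toRingHom_eq_coe, RingHom.coe_coe, MvPolynomial.aeval_X] at hle
  rw [minorIdeal_eq_bot_of_rows hu _ fun i c hi => by simp [t, hi.not_gt],
    minorIdeal_eq_bot_of_rows hv _ fun i c hi => by simp [t, hi.not_gt], sup_bot_eq] at hle
  have hpos : ∀ s : Fin w, 0 < v - 1 := fun s => by
    rcases Nat.eq_zero_or_pos (v - 1) with h0 | h0
    · rw [h0, mul_zero] at h
      exact absurd s.2 (by omega)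
    · exact h0
  have hdiv : ∀ s : Fin w, (s : ℕ) / (v - 1) < u - 1 := fun s =>
    Nat.div_lt_of_lt_mul (by rw [mul_comm]; exact s.2.trans_le h)
  have hmod : ∀ s : Fin w, (s : ℕ) % (v - 1) < v - 1 := fun s => Nat.mod_lt _ (hpos s)
  -- Division with remainder by `v - 1` inverts the numbering, so the chosen submatrix is the
  -- identity.
  have hmem := hle (det_mem_minorIdeal _ (Fin.castLE hwr) fun s : Fin w =>
    (⟨s / (v - 1), by have := hdiv s; omega⟩, ⟨s % (v - 1), by have := hmod s; omega⟩))
  have hone : (Matrix.of fun s k : Fin w => t (⟨k / (v - 1), by have := hdiv k; omega⟩,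
      ⟨k % (v - 1), by have := hmod k; omega⟩, Fin.castLE hwr s)) = 1 := by
    ext s k
    simp [t, hdiv, hmod, Nat.div_add_mod', Matrix.one_apply, Fin.ext_iff, eq_comm]
  rw [hone, Matrix.det_one] at hmem
  exact one_ne_zero (Ideal.mem_bot.1 hmem)

theorem isDoubleDeterminantal_minorIdeal_sup {K σ : Type*} [Field K] {p q s : ℕ} {a b : ℕ}
    (ha : 0 < a) (hb : 0 < b) (e : Fin p × Fin q × Fin s ≃ σ) :
    IsDoubleDeterminantal (
      minorIdeal a (fun i (c : Fin q × Fin s) =>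
        (MvPolynomial.X (e (i, c.1, c.2)) : MvPolynomial σ K)) ⊔
      minorIdeal b (fun j (c : Fin p × Fin s) =>
        (MvPolynomial.X (e (c.1, j, c.2)) : MvPolynomial σ K))) := by
  refine ⟨p, q, s, a, b, e, ha, hb, _, ⟨finProdFinEquiv.symm, rfl⟩, _,
    ⟨finProdFinEquiv.symm, rfl⟩, ?_⟩
  rw [doubleIdeal, Ideal.span_union,
    ← Ideal.span_minorSet_eq_minorIdeal (b := q * s) a _ finProdFinEquiv.symm,
    ← Ideal.span_minorSet_eq_minorIdeal (b := p * s) b _ finProdFinEquiv.symm]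

theorem proposition3 {K : Type*} [Field K] (m n r u v w : ℕ)
    (hu : 2 ≤ u) (hum : u ≤ min m (r * n))
    (hv : 2 ≤ v) (hvn : v ≤ min n (m * r))
    (hw : 2 ≤ w) (hwr : w ≤ min r (m * n))
    (X₁ : Matrix (Fin m) (Fin (n * r)) (MvPolynomial (Fin m × Fin n × Fin r) K))
    (hX₁ : X₁ ∈ firstFlattenings (genericTensor K m n r))
    (X₂ : Matrix (Fin n) (Fin (m * r)) (MvPolynomial (Fin m × Fin n × Fin r) K))
    (hX₂ : X₂ ∈ secondFlattenings (genericTensor K m n r))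
    (X₃ : Matrix (Fin r) (Fin (m * n)) (MvPolynomial (Fin m × Fin n × Fin r) K))
    (hX₃ : X₃ ∈ thirdFlattenings (genericTensor K m n r)) :
    (doubleIdeal u v X₁ X₂ = tripleIdeal u v w X₁ X₂ X₃ ↔ (u - 1) * (v - 1) ≤ w - 1) ∧
    ((u - 1) * (w - 1) ≤ v - 1 → tripleIdeal u v w X₁ X₂ X₃ = doubleIdeal u w X₁ X₃) ∧
    ((v - 1) * (w - 1) ≤ u - 1 → tripleIdeal u v w X₁ X₂ X₃ = doubleIdeal v w X₂ X₃) ∧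
    ((u - 1) * (v - 1) ≤ w - 1 ∨ (u - 1) * (w - 1) ≤ v - 1 ∨ (v - 1) * (w - 1) ≤ u - 1 →
      IsDoubleDeterminantal (tripleIdeal u v w X₁ X₂ X₃)) := by
  obtain ⟨e₁, rfl⟩ := hX₁
  obtain ⟨e₂, rfl⟩ := hX₂
  obtain ⟨e₃, rfl⟩ := hX₃
  simp only [doubleIdeal, tripleIdeal, Ideal.span_union]
  rw [Ideal.span_minorSet_eq_minorIdeal u
      (fun i (c : Fin n × Fin r) => genericTensor K m n r i c.1 c.2) e₁,
    Ideal.span_minorSet_eq_minorIdeal v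
      (fun j (c : Fin m × Fin r) => genericTensor K m n r c.1 j c.2) e₂,
    Ideal.span_minorSet_eq_minorIdeal w
      (fun k (c : Fin m × Fin n) => genericTensor K m n r c.1 c.2 k) e₃]
  set I₁ := minorIdeal u fun i (c : Fin n × Fin r) => genericTensor K m n r i c.1 c.2 with hI₁
  set I₂ := minorIdeal v fun j (c : Fin m × Fin r) => genericTensor K m n r c.1 j c.2 with hI₂
  set I₃ := minorIdeal w fun k (c : Fin m × Fin n) => genericTensor K m n r c.1 c.2 k with hI₃
  have hI₁' : (minorIdeal u fun i (c : Fin r × Fin n) => genericTensor K m n r i c.2 c.1) = I₁ :=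
    minorIdeal_comp_equiv u (fun i (c : Fin n × Fin r) => genericTensor K m n r i c.1 c.2)
      (Equiv.prodComm _ _)
  have hI₂' : (minorIdeal v fun j (c : Fin r × Fin m) => genericTensor K m n r c.2 j c.1) = I₂ :=
    minorIdeal_comp_equiv v (fun j (c : Fin m × Fin r) => genericTensor K m n r c.1 j c.2)
      (Equiv.prodComm _ _)
  have hI₃' : (minorIdeal w fun k (c : Fin n × Fin m) => genericTensor K m n r c.2 c.1 k) = I₃ :=
    minorIdeal_comp_equiv w (fun k (c : Fin m × Fin n) => genericTensor K m n r c.1 c.2 k)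
      (Equiv.prodComm _ _)
  have h₃ : (u - 1) * (v - 1) ≤ w - 1 → I₃ ≤ I₁ ⊔ I₂ := fun h =>
    minorIdeal_third_le (by omega) (by omega) (by omega) h _
  -- The other two cases apply the same containment to the tensor with permuted directions; only the
  -- order of the column pairs has to be corrected.
  have h₂ : (u - 1) * (w - 1) ≤ v - 1 → I₂ ≤ I₁ ⊔ I₃ := fun h => by
    have := minorIdeal_third_le (by omega) (by omega) (by omega) h
      (fun i k j => genericTensor K m n r i j k)
    rwa [hI₁'] at this
  have h₁ : (v - 1) * (w - 1) ≤ u - 1 → I₁ ≤ I₂ ⊔ I₃ := fun h => by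
    have := minorIdeal_third_le (by omega) (by omega) (by omega) h
      (fun j k i => genericTensor K m n r i j k)
    rw [hI₂', hI₃'] at this
    refine le_trans (le_of_eq ?_) this
    rfl
  have heq₃ : (u - 1) * (v - 1) ≤ w - 1 → I₁ ⊔ I₂ ⊔ I₃ = I₁ ⊔ I₂ := fun h =>
    sup_eq_left.2 (h₃ h)
  have heq₂ : (u - 1) * (w - 1) ≤ v - 1 → I₁ ⊔ I₂ ⊔ I₃ = I₁ ⊔ I₃ := fun h => by
    rw [sup_right_comm]
    exact sup_eq_left.2 (h₂ h)
  have heq₁ : (v - 1) * (w - 1) ≤ u - 1 → I₁ ⊔ I₂ ⊔ I₃ = I₂ ⊔ I₃ := fun h => by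
    rw [sup_assoc]
    exact sup_eq_right.2 (h₁ h)
  refine ⟨⟨fun h => ?_, fun h => (heq₃ h).symm⟩, heq₂, heq₁, ?_⟩
  · by_contra hlt
    exact not_minorIdeal_third_le K (by omega) (by omega) (by omega) (by omega) (by omega)
      (by omega) (sup_eq_left.1 h.symm)
  · rintro (h | h | h)
    · rw [heq₃ h]
      exact isDoubleDeterminantal_minorIdeal_sup (by omega) (by omega) (Equiv.refl _)
    · rw [heq₂ h, ← hI₁']
      exact isDoubleDeterminantal_minorIdeal_sup (p := m) (q := r) (s := n) (by omega) (by omega)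
        ((Equiv.refl _).prodCongr (Equiv.prodComm _ _))
    · rw [heq₁ h, ← hI₂', ← hI₃']
      exact isDoubleDeterminantal_minorIdeal_sup (p := n) (q := r) (s := m) (by omega) (by omega)
        -- Directions are rotated to `(j, k, i)`, so that the second and third flattenings become
        -- the first and second.
        ⟨fun x => (x.2.2, x.1, x.2.1), fun x => (x.2.1, x.2.2, x.1), fun _ => rfl, fun _ => rfl⟩
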